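/- Let $L$ be a frame. A sublocale of $L$ is a subset $S\subseteq L$ closed under arbitrary meets and such that $a\to s\in S$ for all $a\in L$, $s\in S$; it is a frame in the inherited order, with surjection $s:L\to S$, $s(a)=\bigwedge\{t\in S\mid a\le t\}$. The sublocales of $L$, ordered by inclusion, form a coframe $\mathsf{S}(L)$; for $a\in L$ put $\mathfrak{c}(a)=\{b\in L\mid a\le b\}$ and $\mathfrak{o}(a)=\{b\in L\mid a\to b=b\}$. Let $\mathsf{S}_b(L)\subseteq\mathsf{S}(L)$ be the collection of all joins of complemented sublocales; a sublocale is called smooth if it belongs to $\mathsf{S}_b(L)$. Let $\mathsf{S}_{\mathfrak{o}}(L)$ be the coframe of intersections of open sublocales $\mathfrak{o}(x)$, and let $\mathit{fit}(T)=\bigcap\{\mathfrak{o}(x)\mid T\subseteq\mathfrak{o}(x)\}$ for $T\in\mathsf{S}(L)$. A subcolocale of a coframe $C$ is a subset $D\subseteq C$ closed under arbitrary joins and such that $d\setminus c\in D$ for all $d\in D$, $c\in C$; it is a coframe in the inherited order. A strictly zero-dimensional biframe is a pair $(L,\mathcal{D})$ with $\mathcal{D}\subseteq\mathsf{S}(L)$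 a subcolocale containing $L$; a morphism $(L,\mathcal{D})\to(M,\mathcal{E})$ is a frame map $f:L\to M$ such that $\mathfrak{c}(a)\mapsto\mathfrak{c}(f(a))$ extends to a coframe map $\mathcal{D}\to\mathcal{E}$ (a map preserving arbitrary meets and finite joins). A Raney extension is a pair $(L,\mathcal{F})$ with $\mathcal{F}\subseteq\mathsf{S}_{\mathfrak{o}}(L)$ a subcolocale containing all open sublocales; a morphism $(L,\mathcal{F})\to(M,\mathcal{G})$ is a frame map $f:L\to M$ such that $\mathfrak{o}(a)\mapsto\mathfrak{o}(f(a))$ extends to a coframe map $\mathcal{F}\to\mathcal{G}$. The pair $(L,\mathsf{S}_b(L))$ is a strictly zero-dimensional biframe and $(L,\mathit{fit}[\mathsf{S}_b(L)])$ is a Raney extension. A meet $\bigwedge_i x_i$ in a frame is exact if $(\bigwedge_i x_i)\vee y=\bigwedge_i(x_i\vee y)$ for all $y$. A frame map $f$ is exact if, for every exact meet $\bigwedge_i x_i$, the meet $\bigwedge_i f(x_i)$ is exact and equals $f(\bigwedge_i x_i)$. A sublocale is exact if its surjection is exact. Then, for every frame $L$ and every sublocale $S\subseteq L$ with surjection $s:L\to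 S$: \begin{enumerate} \item $S$ is smooth if and only if $s$ is a morphism $(L,\mathsf{S}_b(L))\to(S,\mathsf{S}_b(S))$ of strictly zero-dimensional biframes. \item $S$ is exact if and only if $s$ is a morphism $(L,\mathit{fit}[\mathsf{S}_b(L)])\to(S,\mathit{fit}[\mathsf{S}_b(S)])$ of Raney extensions. \end{enumerate} -/

import Mathlib

universe u v

/-! ### Coframe maps and subcolocales -/

/-- A coframe map: it preserves arbitrary meets (hence the top) and finite joins (hence the
bottom). -/
structure CoframeHom (C : Type u) (D : Type v) [Order.Coframe C] [Order.Coframe D] where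
  toFun : C → D
  map_sInf' : ∀ s : Set C, toFun (sInf s) = sInf (toFun '' s)
  map_sup' : ∀ a b : C, toFun (a ⊔ b) = toFun a ⊔ toFun b
  map_bot' : toFun ⊥ = ⊥

/-- A subcolocale of a coframe `C`: a subset closed under all joins and under `d ↦ d \ c`
for every `c : C`. -/
structure Subcolocale (C : Type u) [Order.Coframe C] where
  carrier : Set C
  sSup_mem' : ∀ s ⊆ carrier, sSup s ∈ carrier
  sdiff_mem' : ∀ d ∈ carrier, ∀ c : C, d \ c ∈ carrier

theorem sdiff_eq_inf_of_isCompl {C : Type u} [Order.Coframe C] {x y : C} (h : IsCompl x y)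
    (c : C) : c \ x = c ⊓ y := by
  refine eq_of_forall_ge_iff fun z => ?_
  rw [sdiff_le_iff]
  constructor
  · intro hc
    calc c ⊓ y ≤ (x ⊔ z) ⊓ y := inf_le_inf_right y hc
      _ = z ⊓ y := by rw [inf_sup_right, h.inf_eq_bot, bot_sup_eq]
      _ ≤ z := inf_le_left
  · intro hc
    calc c = c ⊓ (x ⊔ y) := by rw [h.sup_eq_top, inf_top_eq]
      _ = c ⊓ x ⊔ c ⊓ y := inf_sup_left ..
      _ ≤ x ⊔ z := sup_le_sup inf_le_right hc

namespace Subcolocale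

variable {C : Type u} [Order.Coframe C] (D : Subcolocale C)

/-- The elements of a subcolocale, ordered as in `C`. -/
abbrev Elem : Type u := {c : C // c ∈ D.carrier}

instance : SupSet D.Elem where
  sSup s := ⟨sSup (Subtype.val '' s), D.sSup_mem' _ (by rintro _ ⟨x, -, rfl⟩; exact x.2)⟩

theorem isLUB_sSup_elem (s : Set D.Elem) : IsLUB s (sSup s) :=
  ⟨fun x hx => show x.1 ≤ sSup (Subtype.val '' s) from le_sSup ⟨x, hx, rfl⟩,
    fun y hy => show sSup (Subtype.val '' s) ≤ y.1 from
      sSup_le (by rintro _ ⟨x, hx, rfl⟩; exact hy hx)⟩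

/-- A subcolocale is a complete lattice in the inherited order. Joins are computed in `C`;
the meet of a family is the largest element of the subcolocale below all its members. -/
noncomputable instance : CompleteLattice D.Elem :=
  completeLatticeOfSup D.Elem D.isLUB_sSup_elem

theorem sup_mem {a b : C} (ha : a ∈ D.carrier) (hb : b ∈ D.carrier) : a ⊔ b ∈ D.carrier := by
  rw [← sSup_pair]
  exact D.sSup_mem' _ (by rintro x (rfl | rfl) <;> assumption)

theorem coe_sup (a b : D.Elem) : ((a ⊔ b : D.Elem) : C) = (a : C) ⊔ (b : C) := by
  apply le_antisymm
  · exact show (a ⊔ b : D.Elem) ≤ ⟨(a : C) ⊔ b, D.sup_mem a.2 b.2⟩ from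
      sup_le (show (a : C) ≤ (a : C) ⊔ b from le_sup_left)
        (show (b : C) ≤ (a : C) ⊔ b from le_sup_right)
  · exact sup_le (show a ≤ a ⊔ b from le_sup_left) (show b ≤ a ⊔ b from le_sup_right)

noncomputable instance : Order.Coframe D.Elem := .ofMinimalAxioms {
  iInf_sup_le_sup_sInf := fun a s => by
    let m : D.Elem := ⨅ b ∈ s, a ⊔ b
    have h1 : (m : C) \ (a : C) ∈ D.carrier := D.sdiff_mem' _ m.2 _
    have h2 : (⟨(m : C) \ (a : C), h1⟩ : D.Elem) ≤ sInf s := by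
      refine le_sInf fun b hb => ?_
      change (m : C) \ (a : C) ≤ (b : C)
      rw [sdiff_le_iff, ← coe_sup]
      exact (iInf₂_le b hb : m ≤ a ⊔ b)
    have h3 : (m : C) \ (a : C) ≤ ((sInf s : D.Elem) : C) := h2
    change (m : C) ≤ ((a ⊔ sInf s : D.Elem) : C)
    rw [coe_sup]
    exact sdiff_le_iff.1 h3 }

end Subcolocale

/-! ### Open, closed, smooth and fitted sublocales -/

namespace Sublocale

variable {L : Type u} [Order.Frame L]

/-- The open sublocale `𝔬(a) = {b | a → b = b}`. -/
def opens (a : L) : Sublocale L where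
  carrier := {b | a ⇨ b = b}
  sInf_mem' s hs := by
    refine le_antisymm (le_sInf fun b hb => ?_) le_himp
    calc a ⇨ sInf s ≤ a ⇨ b := himp_le_himp_left (sInf_le hb)
      _ = b := hs hb
  himp_mem' c b hb := by
    change a ⇨ c ⇨ b = c ⇨ b
    rw [himp_left_comm, show a ⇨ b = b from hb]

/-- The closed sublocale `𝔠(a) = ↑a`. -/
def closeds (a : L) : Sublocale L where
  carrier := {b | a ≤ b}
  sInf_mem' _ hs := le_sInf fun _ hb => hs hb
  himp_mem' _ _ hb := le_trans hb le_himp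

theorem mem_inf_of_mem {S T : Sublocale L} {x : L} (hS : x ∈ S) (hT : x ∈ T) : x ∈ S ⊓ T := by
  let I : Sublocale L :=
    { carrier := {y | y ∈ S ∧ y ∈ T}
      sInf_mem' := fun s hs => ⟨sInf_mem fun _ hy => (hs hy).1, sInf_mem fun _ hy => (hs hy).2⟩
      himp_mem' := fun _ _ hb => ⟨himp_mem hb.1, himp_mem hb.2⟩ }
  have h : I ≤ S ⊓ T := le_inf (fun _ hy => hy.1) (fun _ hy => hy.2)
  exact h (show x ∈ I from ⟨hS, hT⟩)

theorem mem_opens {a b : L} : b ∈ opens a ↔ a ⇨ b = b := Iff.rfl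

theorem mem_closeds {a b : L} : b ∈ closeds a ↔ a ≤ b := Iff.rfl

theorem isCompl_opens_closeds (a : L) : IsCompl (opens a) (closeds a) := by
  constructor
  · intro T ho hc x hx
    have h1 : a ⇨ x = x := ho hx
    have h2 : a ≤ x := hc hx
    have : x = ⊤ := by rw [← h1, himp_eq_top_iff]; exact h2
    rw [this]; exact top_mem
  · intro T ho hc x _
    have h1 : a ⇨ x ∈ T := ho (mem_opens.2 himp_idem)
    have h2 : a ⊔ x ∈ T := hc (mem_closeds.2 le_sup_left)
    have h3 : (a ⇨ x) ⊓ (a ⊔ x) = x := by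
      apply le_antisymm
      · rw [inf_sup_left]
        exact sup_le (by rw [himp_inf_self]; exact inf_le_left) inf_le_right
      · exact le_inf le_himp le_sup_right
    rw [← h3]; exact inf_mem h1 h2

theorem opens_sup (a b : L) : opens (a ⊔ b) = opens a ⊔ opens b := by
  apply le_antisymm
  · intro x hx
    have h1 : (a ⊔ b) ⇨ x = x := hx
    rw [← h1, sup_himp_distrib]
    exact inf_mem ((le_sup_left : opens a ≤ opens a ⊔ opens b) (mem_opens.2 himp_idem))
      ((le_sup_right : opens b ≤ opens a ⊔ opens b) (mem_opens.2 himp_idem))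
  · refine sup_le (fun x hx => ?_) (fun x hx => ?_)
    · exact le_antisymm ((himp_le_himp_right le_sup_left).trans_eq hx) le_himp
    · exact le_antisymm ((himp_le_himp_right le_sup_right).trans_eq hx) le_himp

/-- A sublocale is smooth if it is a join, in the coframe of sublocales, of complemented
sublocales. -/
def IsSmooth (S : Sublocale L) : Prop :=
  ∃ 𝒞 : Set (Sublocale L), (∀ C ∈ 𝒞, IsComplemented C) ∧ S = sSup 𝒞

/-- A sublocale is fitted if it is an intersection of open sublocales. -/
def IsFitted (S : Sublocale L) : Prop := ∃ X : Set L, S = ⨅ x ∈ X, opens x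

/-- The fitting of a sublocale: the intersection of the open sublocales containing it. -/
def fit (S : Sublocale L) : Sublocale L := ⨅ x ∈ {x : L | S ≤ opens x}, opens x

theorem isFitted_fit (S : Sublocale L) : IsFitted (fit S) := ⟨_, rfl⟩

theorem isFitted_opens (a : L) : IsFitted (opens a) := ⟨{a}, by simp⟩

theorem le_fit (S : Sublocale L) : S ≤ fit S := le_iInf₂ fun _ hx => hx

theorem fit_le_iff {S T : Sublocale L} (hT : IsFitted T) : fit S ≤ T ↔ S ≤ T := by
  refine ⟨(le_fit S).trans, fun h => ?_⟩
  obtain ⟨X, rfl⟩ := hT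
  exact le_iInf₂ fun x hx => iInf₂_le x (h.trans (iInf₂_le x hx))

theorem fit_eq {T : Sublocale L} (hT : IsFitted T) : fit T = T :=
  le_antisymm ((fit_le_iff hT).2 le_rfl) (le_fit T)

theorem isFitted_sInf {s : Set (Sublocale L)} (hs : ∀ T ∈ s, IsFitted T) : IsFitted (sInf s) := by
  have h : fit (sInf s) = sInf s :=
    le_antisymm (le_sInf fun T hT => (fit_le_iff (hs T hT)).2 (sInf_le hT)) (le_fit _)
  exact h ▸ isFitted_fit _

theorem IsFitted.sup {S T : Sublocale L} (hS : IsFitted S) (hT : IsFitted T) :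
    IsFitted (S ⊔ T) := by
  obtain ⟨X, rfl⟩ := hS
  obtain ⟨Y, rfl⟩ := hT
  have h : fit ((⨅ x ∈ X, opens x) ⊔ ⨅ y ∈ Y, opens y) ≤
      (⨅ x ∈ X, opens x) ⊔ ⨅ y ∈ Y, opens y := by
    simp only [iInf_sup_eq, sup_iInf_eq]
    refine le_iInf₂ fun x hx => le_iInf₂ fun y hy => ?_
    rw [← opens_sup, fit_le_iff (isFitted_opens _), opens_sup]
    exact (iInf₂_le x hx).trans (iInf₂_le y hy)
  exact le_antisymm h (le_fit _) ▸ isFitted_fit _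

/-- Every sublocale is an intersection of sublocales of the form `𝔬(z) ∨ 𝔠(w)`. -/
theorem eq_sInf_opens_sup_closeds (T : Sublocale L) :
    T = sInf {P | T ≤ P ∧ ∃ z w : L, P = opens z ⊔ closeds w} := by
  apply le_antisymm (le_sInf fun P hP => hP.1)
  intro z hz
  have hw : ((T.restrict z : T) : L) ∈ T := (T.restrict z).2
  have hzw : z ≤ ((T.restrict z : T) : L) := T.giRestrict.gc.le_u_l z
  have hT : T ≤ opens z ⊔ closeds ((T.restrict z : T) : L) := by
    intro t ht
    have h1 : ((T.restrict z : T) : L) ⊓ (z ⇨ t) ≤ t := by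
      rw [← le_himp_iff]
      have hmem : (z ⇨ t) ⇨ t ∈ T := himp_mem ht
      have : T.restrict z ≤ ⟨(z ⇨ t) ⇨ t, hmem⟩ :=
        (T.giRestrict.gc z _).2 (by
          change z ≤ (z ⇨ t) ⇨ t
          rw [le_himp_iff, inf_himp]; exact inf_le_right)
      exact this
    have h2 : (z ⇨ t) ⊓ (((T.restrict z : T) : L) ⊔ t) = t := by
      apply le_antisymm
      · rw [inf_sup_left]
        exact sup_le (by rw [inf_comm]; exact h1) inf_le_right
      · exact le_inf le_himp le_sup_right
    rw [← h2]
    exact inf_mem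
      ((le_sup_left : opens z ≤ opens z ⊔ closeds ((T.restrict z : T) : L))
        (mem_opens.2 himp_idem))
      ((le_sup_right : closeds ((T.restrict z : T) : L) ≤
        opens z ⊔ closeds ((T.restrict z : T) : L)) (mem_closeds.2 le_sup_left))
  have hz' : z ∈ opens z ⊔ closeds ((T.restrict z : T) : L) :=
    (sInf_le ⟨hT, z, _, rfl⟩ : sInf {P | T ≤ P ∧ ∃ z w : L, P = opens z ⊔ closeds w} ≤ _) hz
  have h3 : closeds z ⊓ (opens z ⊔ closeds ((T.restrict z : T) : L)) ≤
      closeds ((T.restrict z : T) : L) := by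
    rw [inf_sup_left, inf_comm, (isCompl_opens_closeds z).inf_eq_bot, bot_sup_eq]
    exact inf_le_right
  have h5 : ((T.restrict z : T) : L) ≤ z :=
    mem_closeds.1 (h3 (mem_inf_of_mem (mem_closeds.2 le_rfl) hz'))
  rw [le_antisymm hzw h5]
  exact hw

/-- Joins of complemented sublocales are stable under differences. -/
theorem IsSmooth.sdiff {S : Sublocale L} (hS : IsSmooth S) (T : Sublocale L) :
    IsSmooth (S \ T) := by
  obtain ⟨𝒞, h𝒞, rfl⟩ := hS
  refine ⟨{U | IsComplemented U ∧ U ≤ sSup 𝒞 \ T}, fun U hU => hU.1, ?_⟩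
  refine le_antisymm ?_ (sSup_le fun U hU => hU.2)
  rw [sdiff_le_iff]
  refine sSup_le fun C hC => ?_
  have hT := eq_sInf_opens_sup_closeds T
  set V := sSup {U | IsComplemented U ∧ U ≤ sSup 𝒞 \ T}
  rw [hT, sInf_sup_eq]
  refine le_iInf₂ fun P hP => ?_
  obtain ⟨hTP, z, w, rfl⟩ := hP
  rw [← sdiff_le_iff]
  refine le_sSup ⟨?_, sdiff_le_sdiff (le_sSup hC) hTP⟩
  have hc : IsCompl (opens z ⊔ closeds w) (closeds z ⊓ opens w) :=
    (isCompl_opens_closeds z).sup_inf (isCompl_opens_closeds w).symm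
  rw [sdiff_eq_inf_of_isCompl hc]
  exact (h𝒞 C hC).inf ⟨_, hc.symm⟩

theorem isSmooth_sSup {s : Set (Sublocale L)} (hs : ∀ T ∈ s, IsSmooth T) :
    IsSmooth (sSup s) := by
  refine ⟨{U | IsComplemented U ∧ U ≤ sSup s}, fun U hU => hU.1, ?_⟩
  refine le_antisymm (sSup_le fun T hT => ?_) (sSup_le fun U hU => hU.2)
  obtain ⟨𝒞, h𝒞, rfl⟩ := hs T hT
  exact sSup_le fun C hC => le_sSup ⟨h𝒞 C hC, (le_sSup hC).trans (le_sSup hT)⟩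

/-- `𝖲_b(L)`: the subcolocale of joins of complemented sublocales. -/
def Sb (L : Type u) [Order.Frame L] : Subcolocale (Sublocale L) where
  carrier := {S | IsSmooth S}
  sSup_mem' _ hs := isSmooth_sSup hs
  sdiff_mem' _ hd T := hd.sdiff T

/-- `𝖲_𝔬(L)`: the fitted sublocales of `L`, ordered by inclusion. -/
abbrev Fitted (L : Type u) [Order.Frame L] : Type u := {S : Sublocale L // IsFitted S}

namespace Fitted

instance : InfSet (Fitted L) where
  sInf s := ⟨sInf (Subtype.val '' s), isFitted_sInf (by rintro _ ⟨x, -, rfl⟩; exact x.2)⟩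

theorem isGLB_sInf_fitted (s : Set (Fitted L)) : IsGLB s (sInf s) :=
  ⟨fun x hx => show sInf (Subtype.val '' s) ≤ x.1 from sInf_le ⟨x, hx, rfl⟩,
    fun y hy => show y.1 ≤ sInf (Subtype.val '' s) from
      le_sInf (by rintro _ ⟨x, hx, rfl⟩; exact hy hx)⟩

/-- Meets of fitted sublocales are intersections. -/
noncomputable instance : CompleteLattice (Fitted L) :=
  completeLatticeOfInf (Fitted L) isGLB_sInf_fitted

theorem coe_sInf (s : Set (Fitted L)) :
    ((sInf s : Fitted L) : Sublocale L) = sInf (Subtype.val '' s) := rfl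

theorem coe_sup (S T : Fitted L) :
    ((S ⊔ T : Fitted L) : Sublocale L) = (S : Sublocale L) ⊔ (T : Sublocale L) := by
  apply le_antisymm
  · exact show (S ⊔ T : Fitted L) ≤ ⟨(S : Sublocale L) ⊔ T, S.2.sup T.2⟩ from
      sup_le (show (S : Sublocale L) ≤ (S : Sublocale L) ⊔ T from le_sup_left)
        (show (T : Sublocale L) ≤ (S : Sublocale L) ⊔ T from le_sup_right)
  · exact sup_le (show S ≤ S ⊔ T from le_sup_left) (show T ≤ S ⊔ T from le_sup_right)

noncomputable instance : Order.Coframe (Fitted L) := .ofMinimalAxioms {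
  iInf_sup_le_sup_sInf := fun a s => by
    change ((⨅ b ∈ s, a ⊔ b : Fitted L) : Sublocale L) ≤ ((a ⊔ sInf s : Fitted L) : Sublocale L)
    rw [coe_sup, coe_sInf, sup_sInf_eq]
    refine le_iInf₂ fun b hb => ?_
    obtain ⟨b, hb, rfl⟩ := hb
    rw [← coe_sup]
    exact (iInf₂_le b hb : (⨅ b ∈ s, a ⊔ b) ≤ a ⊔ b) }

end Fitted

/-- The fitting as a map `𝖲(L) → 𝖲_𝔬(L)`. -/
def fitMap (S : Sublocale L) : Fitted L := ⟨fit S, isFitted_fit S⟩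

theorem fitMap_le_iff {S : Sublocale L} {F : Fitted L} : fitMap S ≤ F ↔ S ≤ (F : Sublocale L) :=
  fit_le_iff F.2

/-- An open sublocale as an element of `𝖲_𝔬(L)`. -/
def openFitted (a : L) : Fitted L := ⟨opens a, isFitted_opens a⟩

end Sublocale

/-- The direct image `fit[𝒟] ⊆ 𝖲_𝔬(L)` of a subcolocale `𝒟 ⊆ 𝖲(L)`. -/
def Subcolocale.fitImage {L : Type u} [Order.Frame L] (D : Subcolocale (Sublocale L)) :
    Subcolocale (Sublocale.Fitted L) where
  carrier := Sublocale.fitMap '' D.carrier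
  sSup_mem' s hs := by
    refine ⟨sSup {T | T ∈ D.carrier ∧ Sublocale.fitMap T ∈ s},
      D.sSup_mem' _ fun T hT => hT.1, le_antisymm ?_ (sSup_le fun F hF => ?_)⟩
    · rw [Sublocale.fitMap_le_iff]
      exact sSup_le fun T hT => Sublocale.fitMap_le_iff.1 (le_sSup hT.2)
    · obtain ⟨T, hT, rfl⟩ := hs hF
      rw [Sublocale.fitMap_le_iff]
      exact (le_sSup (show T ∈ {T | T ∈ D.carrier ∧ Sublocale.fitMap T ∈ s} from ⟨hT, hF⟩)).trans
        (Sublocale.le_fit _)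
  sdiff_mem' := by
    rintro _ ⟨T, hT, rfl⟩ G
    refine ⟨T \ (G : Sublocale L), D.sdiff_mem' T hT _, eq_of_forall_ge_iff fun H => ?_⟩
    rw [Sublocale.fitMap_le_iff, sdiff_le_iff, sdiff_le_iff, Sublocale.fitMap_le_iff,
      Sublocale.Fitted.coe_sup]

/-! ### Exactness -/

/-- The meet of `X` is exact: it distributes over binary joins. -/
def IsExactMeet {L : Type u} [Order.Frame L] (X : Set L) : Prop :=
  ∀ y : L, sInf X ⊔ y = ⨅ x ∈ X, x ⊔ y

/-- A frame map is exact if it sends exact meets to exact meets and preserves them. -/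
def IsExactFrameHom {L : Type u} {M : Type v} [Order.Frame L] [Order.Frame M]
    (f : FrameHom L M) : Prop :=
  ∀ X : Set L, IsExactMeet X → IsExactMeet (f '' X) ∧ sInf (f '' X) = f (sInf X)

/-- A sublocale is exact if its surjection `L → S` is an exact frame map. -/
def Sublocale.IsExact {L : Type u} [Order.Frame L] (S : Sublocale L) : Prop :=
  IsExactFrameHom S.restrict

/-! ### Strictly zero-dimensional biframes and Raney extensions -/

/-- A strictly zero-dimensional biframe with first component `L`: a codense subcolocale of the
coframe of sublocales of `L`, i.e. one that contains `L` itself. -/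
structure SZDBiframe (L : Type u) [Order.Frame L] where
  sub : Subcolocale (Sublocale L)
  top_mem : ⊤ ∈ sub.carrier

namespace SZDBiframe

variable {L : Type u} [Order.Frame L]

theorem closeds_mem (A : SZDBiframe L) (a : L) : Sublocale.closeds a ∈ A.sub.carrier := by
  have h := A.sub.sdiff_mem' _ A.top_mem (Sublocale.opens a)
  rwa [sdiff_eq_inf_of_isCompl (Sublocale.isCompl_opens_closeds a), top_inf_eq] at h

theorem opens_mem (A : SZDBiframe L) (a : L) : Sublocale.opens a ∈ A.sub.carrier := by
  have h := A.sub.sdiff_mem' _ A.top_mem (Sublocale.closeds a)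
  rwa [sdiff_eq_inf_of_isCompl (Sublocale.isCompl_opens_closeds a).symm, top_inf_eq] at h

/-- The closed sublocale `𝔠(a)` as an element of the subcolocale. -/
def closed (A : SZDBiframe L) (a : L) : A.sub.Elem := ⟨Sublocale.closeds a, A.closeds_mem a⟩

/-- `f : L → M` is (lifts to) a morphism of strictly zero-dimensional biframes if the assignment
`𝔠(a) ↦ 𝔠(f a)` extends to a coframe map between the subcolocales. -/
def IsMorphism {M : Type v} [Order.Frame M] (A : SZDBiframe L) (B : SZDBiframe M)
    (f : FrameHom L M) : Prop :=
  ∃ g : CoframeHom A.sub.Elem B.sub.Elem, ∀ a : L, g.toFun (A.closed a) = B.closed (f a)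

/-- The strictly zero-dimensional biframe `(L, 𝖲_b(L))`. -/
def ofSb (L : Type u) [Order.Frame L] : SZDBiframe L where
  sub := Sublocale.Sb L
  top_mem := ⟨{⊤}, by rintro _ rfl; exact isComplemented_top, by simp⟩

end SZDBiframe

/-- A Raney extension of `L`: a subcolocale of the coframe of fitted sublocales of `L` that
contains all open sublocales. -/
structure RaneyExtension (L : Type u) [Order.Frame L] where
  sub : Subcolocale (Sublocale.Fitted L)
  open_mem : ∀ a : L, Sublocale.openFitted a ∈ sub.carrier

namespace RaneyExtension

variable {L : Type u} [Order.Frame L]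

/-- The open sublocale `𝔬(a)` as an element of the subcolocale. -/
def opn (A : RaneyExtension L) (a : L) : A.sub.Elem := ⟨Sublocale.openFitted a, A.open_mem a⟩

/-- `f : L → M` is (lifts to) a morphism of Raney extensions if the assignment
`𝔬(a) ↦ 𝔬(f a)` extends to a coframe map between the subcolocales. -/
def IsMorphism {M : Type v} [Order.Frame M] (A : RaneyExtension L) (B : RaneyExtension M)
    (f : FrameHom L M) : Prop :=
  ∃ g : CoframeHom A.sub.Elem B.sub.Elem, ∀ a : L, g.toFun (A.opn a) = B.opn (f a)

end RaneyExtension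

/-- The Raney extension `(L, fit[𝒟])` of a strictly zero-dimensional biframe `(L, 𝒟)`. -/
def SZDBiframe.fit {L : Type u} [Order.Frame L] (A : SZDBiframe L) : RaneyExtension L where
  sub := A.sub.fitImage
  open_mem a := ⟨Sublocale.opens a, A.opens_mem a,
    Subtype.ext (Sublocale.fit_eq (Sublocale.isFitted_opens a))⟩

/-!
Both kinds of morphism are governed by one extension criterion. If `p : ι → C` meet-generates a
coframe and `p`, `q : ι → D` preserve finite joins, then `q` extends along `p` to a coframe map if
and only if `⨅ x ∈ X, p x ≤ p y` always implies `⨅ x ∈ X, q x ≤ q y`: the extension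
`c ↦ ⨅ x ∈ {x | c ≤ p x}, q x` then has the left adjoint `d ↦ ⨅ x ∈ {x | d ≤ q x}, p x`.

*Smoothness.* A subcolocale `𝒟 ∋ L` of `𝖲(L)` is meet-generated by the sublocales `𝔬(z) ∨ 𝔠(w)`,
and the surjection of `S` pulls these back to the trace on `S`. If `S ∈ 𝒟`, the criterion holds for
the subcolocale that `𝒟` induces on `S`, and for smooth `S` the one induced by `𝖲_b(L)` is
`𝖲_b(S)`. Conversely, if the surjection is a morphism from `(L, 𝒟)`, then the meet in `𝒟` of all
`𝔬(z) ∨ 𝔠(w)` containing `S` is contained in no other ones, so it is `S`.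

*Exactness.* The coframe `fit[𝖲_b(L)]` is meet-generated by the open sublocales. Testing on the
locally closed sublocales `𝔬(w) ∩ 𝔠(z)` shows that `⨅ x ∈ X, 𝔬(x) ≤ 𝔬(y)` holds there exactly
when `⨅ x ∈ X, x ⊔ z ≤ y ⊔ z` for all `z`, and a frame map is exact if and only if it preserves
this relation between `X` and `y`, since the relation says that `{x ⊔ y | x ∈ X}` has the exact
meet `y`.
-/

open OrderDual

/-! ### Extending maps from meet-generators -/

namespace CoframeHom

variable {C : Type u} {D : Type v} [Order.Coframe C] [Order.Coframe D] (g : CoframeHom C D)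

theorem map_top : g.toFun ⊤ = ⊤ := by simpa using g.map_sInf' ∅

theorem map_inf (a b : C) : g.toFun (a ⊓ b) = g.toFun a ⊓ g.toFun b := by
  simpa [Set.image_pair] using g.map_sInf' {a, b}

theorem monotone : Monotone g.toFun := fun a b h => by
  rw [← sup_eq_right.2 h, g.map_sup']
  exact le_sup_left

theorem map_isCompl {a b : C} (h : IsCompl a b) : IsCompl (g.toFun a) (g.toFun b) :=
  IsCompl.of_eq (by rw [← g.map_inf, h.inf_eq_bot, g.map_bot'])
    (by rw [← g.map_sup', h.sup_eq_top, g.map_top])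

theorem map_biInf {ι : Type*} (p : ι → C) (X : Set ι) :
    g.toFun (⨅ x ∈ X, p x) = ⨅ x ∈ X, g.toFun (p x) := by
  rw [← sInf_image, g.map_sInf', Set.image_image, sInf_image]

theorem exists_extension_iff {ι : Type*} [SemilatticeSup ι] [OrderBot ι] {p : ι → C} {q : ι → D}
    (hgen : ∀ c c' : C, (∀ x, c' ≤ p x → c ≤ p x) → c ≤ c')
    (hp_sup : ∀ x y, p (x ⊔ y) = p x ⊔ p y) (hp_bot : p ⊥ = ⊥)
    (hq_sup : ∀ x y, q (x ⊔ y) = q x ⊔ q y) (hq_bot : q ⊥ = ⊥) :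
    (∃ g : CoframeHom C D, ∀ x, g.toFun (p x) = q x) ↔
      ∀ (X : Set ι) (y : ι), ⨅ x ∈ X, p x ≤ p y → ⨅ x ∈ X, q x ≤ q y := by
  refine ⟨fun ⟨g, hg⟩ X y h => by simpa only [map_biInf, hg] using g.monotone h, fun H => ?_⟩
  let g (c : C) : D := ⨅ x ∈ {x | c ≤ p x}, q x
  have hg_le {c : C} {y : ι} (h : c ≤ p y) : g c ≤ q y := iInf₂_le y h
  let l (d : D) : C := ⨅ x ∈ {x | d ≤ q x}, p x
  have hl (d : D) (y : ι) : l d ≤ p y ↔ d ≤ q y :=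
    ⟨fun h => (le_iInf₂ fun _ hx => hx : d ≤ ⨅ x ∈ {x | d ≤ q x}, q x).trans (H _ y h),
      fun h => iInf₂_le y h⟩
  have hgc : GaloisConnection l g := fun d c =>
    ⟨fun h => le_iInf₂ fun x hx => (hl d x).1 (h.trans hx),
      fun h => hgen _ _ fun x hx => (hl d x).2 (h.trans (hg_le hx))⟩
  have hgp (y : ι) : g (p y) = q y :=
    le_antisymm (hg_le le_rfl)
      (le_iInf₂ fun x hx => (hl _ x).1 (((hl _ y).2 le_rfl).trans hx))
  have hg_sup (c c' : C) : g (c ⊔ c') ≤ g c ⊔ g c' := by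
    simp only [g, iInf_sup_eq, sup_iInf_eq]
    refine le_iInf₂ fun y hy => le_iInf₂ fun x hx => ?_
    rw [← hq_sup]
    exact hg_le ((sup_le_sup hx hy).trans_eq (hp_sup ..).symm)
  exact ⟨⟨g, fun s => by rw [hgc.u_sInf, sInf_image],
    fun c c' => le_antisymm (hg_sup c c') (hgc.monotone_u.le_map_sup c c'),
    by rw [← hp_bot, hgp, hq_bot]⟩, hgp⟩

end CoframeHom

namespace SublocaleLattice

open Sublocale

/-! ### Open, closed and basic sublocales -/

section Basic

variable {L : Type u} [Order.Frame L]

theorem opens_le_opens_iff {a b : L} : opens a ≤ opens b ↔ a ≤ b := by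
  refine ⟨fun h => ?_, fun h x hx => le_antisymm ((himp_le_himp_right h).trans_eq hx) le_himp⟩
  have hmem : b ⇨ a ⇨ b = a ⇨ b := h (mem_opens.2 himp_idem)
  rw [himp_left_comm, himp_self, himp_top] at hmem
  exact himp_eq_top_iff.1 hmem.symm

theorem opens_bot : opens (⊥ : L) = ⊥ := by
  refine le_bot_iff.1 fun x hx => ?_
  rw [mem_opens, bot_himp] at hx
  exact hx ▸ top_mem

theorem closeds_anti : Antitone (closeds : L → Sublocale L) := fun _ _ h _ hx => h.trans hx

theorem closeds_inf (a b : L) : closeds (a ⊓ b) = closeds a ⊔ closeds b := by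
  refine le_antisymm (fun x hx => ?_)
    (sup_le (closeds_anti inf_le_left) (closeds_anti inf_le_right))
  rw [← sup_eq_right.2 (mem_closeds.1 hx), sup_inf_right]
  exact inf_mem ((le_sup_left : closeds a ≤ _) (mem_closeds.2 le_sup_left))
    ((le_sup_right : closeds b ≤ _) (mem_closeds.2 le_sup_left))

theorem closeds_top : closeds (⊤ : L) = ⊥ :=
  le_bot_iff.1 fun _ hx => top_le_iff.1 (mem_closeds.1 hx) ▸ top_mem

theorem le_opens_iff_closeds_le {C D : Sublocale L} (h : IsCompl C D) {x : L} :
    C ≤ opens x ↔ closeds x ≤ D := by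
  rw [← (isCompl_opens_closeds x).disjoint_right_iff, disjoint_comm, h.disjoint_left_iff]

theorem opens_inf_closeds_le_opens_iff {w z x : L} :
    opens w ⊓ closeds z ≤ opens x ↔ w ≤ x ⊔ z := by
  rw [← (isCompl_opens_closeds z).symm.le_sup_right_iff_inf_left_le, ← opens_sup,
    opens_le_opens_iff]

/-- The complemented sublocale `𝔬(z) ∨ 𝔠(w)` of the pair `p = (z, w)`. These meet-generate
`𝖲(L)`. The second coordinate lives in the order dual, which makes `basic` preserve finite joins. -/
def basic (p : L × Lᵒᵈ) : Sublocale L := opens p.1 ⊔ closeds (ofDual p.2)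

theorem basic_sup (p p' : L × Lᵒᵈ) : basic (p ⊔ p') = basic p ⊔ basic p' := by
  simp only [basic, Prod.fst_sup, Prod.snd_sup, ofDual_sup, opens_sup, closeds_inf]
  exact sup_sup_sup_comm ..

theorem basic_bot : basic (⊥ : L × Lᵒᵈ) = ⊥ := by
  simp only [basic, Prod.fst_bot, Prod.snd_bot, ofDual_bot, opens_bot, closeds_top, bot_sup_eq]

theorem le_basic_iff {T : Sublocale L} {p : L × Lᵒᵈ} :
    T ≤ basic p ↔ ∀ t ∈ T, p.1 ≤ t → ofDual p.2 ≤ t := by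
  rw [basic, sup_comm, (isCompl_opens_closeds p.1).symm.le_sup_right_iff_inf_left_le]
  exact ⟨fun h t ht hp => h (mem_inf_of_mem ht hp),
    fun h t ht => h t ((inf_le_left : _ ≤ T) ht) ((inf_le_right : _ ≤ closeds p.1) ht)⟩

theorem le_of_forall_le_basic {T T' : Sublocale L} (h : ∀ p, T' ≤ basic p → T ≤ basic p) :
    T ≤ T' := by
  rw [eq_sInf_opens_sup_closeds T']
  refine le_sInf ?_
  rintro _ ⟨hT', z, w, rfl⟩
  exact h (z, toDual w) hT'

/-- The action of a frame map on the indices of `basic`. -/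
def mapPair {M : Type v} [Order.Frame M] (f : FrameHom L M) (p : L × Lᵒᵈ) : M × Mᵒᵈ :=
  (f p.1, toDual (f (ofDual p.2)))

theorem mapPair_sup {M : Type v} [Order.Frame M] (f : FrameHom L M) (p p' : L × Lᵒᵈ) :
    mapPair f (p ⊔ p') = mapPair f p ⊔ mapPair f p' :=
  Prod.ext (map_sup f ..) (congrArg toDual (map_inf f (ofDual p.2) (ofDual p'.2)))

theorem mapPair_bot {M : Type v} [Order.Frame M] (f : FrameHom L M) :
    mapPair f ⊥ = ⊥ :=
  Prod.ext (map_bot f) (congrArg toDual (map_top f))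

theorem isSmooth_of_isComplemented {C : Sublocale L} (h : IsComplemented C) : IsSmooth C :=
  ⟨{C}, by rintro _ rfl; exact h, sSup_singleton.symm⟩

end Basic

/-! ### Sublocales of a sublocale -/

section Relative

variable {L : Type u} [Order.Frame L] (S : Sublocale L)

theorem coe_restrict_himp (a : L) (b : S) : ((S.restrict a ⇨ b : S) : L) = a ⇨ b := by
  refine le_antisymm (himp_le_himp_right (S.giRestrict.gc.le_u_l a)) (le_himp_comm.1 ?_)
  have hle : S.restrict a ≤ ⟨(a ⇨ b) ⇨ b, himp_mem b.2⟩ :=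
    (S.giRestrict.gc _ _).2 (le_himp_comm.1 le_rfl)
  exact hle

/-- A sublocale of `S`, regarded as a sublocale of `L`. -/
def extend (U : Sublocale S) : Sublocale L where
  carrier := Subtype.val '' (U : Set S)
  sInf_mem' s hs := by
    obtain ⟨t, ht, rfl⟩ := Set.subset_image_iff.1 hs
    exact ⟨sInf t, sInf_mem ht, rfl⟩
  himp_mem' := by
    rintro a _ ⟨b, hb, rfl⟩
    exact ⟨S.restrict a ⇨ b, himp_mem hb, coe_restrict_himp S a b⟩

/-- The intersection of a sublocale of `L` with `S`, regarded as a sublocale of `S`. -/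
def trace (T : Sublocale L) : Sublocale S where
  carrier := {x | (x : L) ∈ T}
  sInf_mem' s hs := sInf_mem (S := T) (by rintro _ ⟨x, hx, rfl⟩; exact hs hx)
  himp_mem' _ b hb := himp_mem (S := T) (b := (b : L)) hb

theorem gc_extend_trace : GaloisConnection (extend S) (trace S) := fun _ _ => Set.image_subset_iff

variable {S}

theorem extend_le (U : Sublocale S) : extend S U ≤ S := by
  rintro _ ⟨x, -, rfl⟩
  exact x.2

theorem trace_extend (U : Sublocale S) : trace S (extend S U) = U :=
  Sublocale.ext fun _ => Subtype.val_injective.mem_set_image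

theorem extend_trace (T : Sublocale L) : extend S (trace S T) = S ⊓ T :=
  le_antisymm (le_inf (extend_le _) ((gc_extend_trace S).l_u_le T)) fun x hx =>
    ⟨⟨x, (inf_le_left : _ ≤ S) hx⟩, (inf_le_right : _ ≤ T) hx, rfl⟩

theorem extend_trace_of_le {T : Sublocale L} (h : T ≤ S) : extend S (trace S T) = T := by
  rw [extend_trace, inf_eq_right.2 h]

theorem extend_injective : Function.Injective (extend S) :=
  Function.LeftInverse.injective trace_extend

theorem extend_top : extend S ⊤ = S := by
  rw [← (gc_extend_trace S).u_top, extend_trace, inf_top_eq]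

theorem trace_bot : trace S ⊥ = ⊥ := by
  rw [← (gc_extend_trace S).l_bot, trace_extend]

theorem trace_sup (T T' : Sublocale L) : trace S (T ⊔ T') = trace S T ⊔ trace S T' := by
  apply extend_injective
  simp only [(gc_extend_trace S).l_sup, extend_trace, inf_sup_left]

theorem isComplemented_trace {C : Sublocale L} (h : IsComplemented C) :
    IsComplemented (trace S C) := by
  obtain ⟨D, hD⟩ := h
  refine ⟨trace S D, IsCompl.of_eq ?_ ?_⟩
  · rw [← (gc_extend_trace S).u_inf, hD.inf_eq_bot, trace_bot]
  · rw [← trace_sup, hD.sup_eq_top, (gc_extend_trace S).u_top]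

theorem extend_sdiff (U V : Sublocale S) : extend S (U \ V) = extend S U \ extend S V :=
  eq_of_forall_ge_iff fun T => by
    rw [gc_extend_trace S, sdiff_le_iff, sdiff_le_iff, gc_extend_trace S, trace_sup, trace_extend]

theorem extend_le_basic_iff {U : Sublocale S} {p : L × Lᵒᵈ} :
    extend S U ≤ basic p ↔ U ≤ basic (mapPair S.restrict p) := by
  simp only [le_basic_iff, mapPair, ofDual_toDual, S.giRestrict.gc _ _]
  exact Set.forall_mem_image

theorem isSmooth_of_isSmooth_extend {U : Sublocale S} (hU : IsSmooth (extend S U)) :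
    IsSmooth U := by
  obtain ⟨𝒞, h𝒞, hU⟩ := hU
  have hle : ∀ C ∈ 𝒞, C ≤ S := fun C hC => (le_sSup hC).trans (hU ▸ extend_le U)
  refine ⟨trace S '' 𝒞, ?_, extend_injective ?_⟩
  · rintro _ ⟨C, hC, rfl⟩
    exact isComplemented_trace (h𝒞 C hC)
  · rw [hU, (gc_extend_trace S).l_sSup, iSup_image, sSup_eq_iSup]
    exact iSup_congr fun C => iSup_congr fun hC => (extend_trace_of_le (hle C hC)).symm

theorem isSmooth_extend (hS : IsSmooth S) {U : Sublocale S} (hU : IsSmooth U) :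
    IsSmooth (extend S U) := by
  obtain ⟨𝒞, h𝒞, rfl⟩ := hU
  rw [(gc_extend_trace S).l_sSup, ← sSup_image]
  refine isSmooth_sSup ?_
  rintro _ ⟨C, hC, rfl⟩
  obtain ⟨D, hD⟩ := h𝒞 C hC
  have hC_eq : extend S C = S \ extend S D := by
    rw [← top_inf_eq C, ← sdiff_eq_inf_of_isCompl hD.symm, extend_sdiff, extend_top]
  exact hC_eq ▸ hS.sdiff _

end Relative

end SublocaleLattice

/-! ### Morphisms of strictly zero-dimensional biframes -/

namespace SZDBiframe

open Sublocale SublocaleLattice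

variable {L : Type u} {M : Type v} [Order.Frame L] [Order.Frame M]

/-- The open sublocale `𝔬(a)` as an element of the subcolocale. -/
def opn (A : SZDBiframe L) (a : L) : A.sub.Elem := ⟨opens a, A.opens_mem a⟩

/-- The sublocale `basic p` as an element of the subcolocale. -/
noncomputable def basicElem (A : SZDBiframe L) (p : L × Lᵒᵈ) : A.sub.Elem :=
  A.opn p.1 ⊔ A.closed (ofDual p.2)

theorem coe_top (A : SZDBiframe L) : ((⊤ : A.sub.Elem) : Sublocale L) = ⊤ :=
  top_le_iff.1 (le_top : (⟨⊤, A.top_mem⟩ : A.sub.Elem) ≤ ⊤)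

theorem coe_basicElem (A : SZDBiframe L) (p : L × Lᵒᵈ) :
    (A.basicElem p : Sublocale L) = basic p :=
  A.sub.coe_sup ..

theorem le_basicElem_iff (A : SZDBiframe L) {T : A.sub.Elem} {p : L × Lᵒᵈ} :
    T ≤ A.basicElem p ↔ (T : Sublocale L) ≤ basic p := by
  rw [← Subtype.coe_le_coe, coe_basicElem]

theorem isCompl_opn_closed (A : SZDBiframe L) (a : L) : IsCompl (A.opn a) (A.closed a) := by
  have h := isCompl_opens_closeds a
  refine ⟨fun T ho hc => ?_, fun T ho hc => ?_⟩
  · exact Subtype.coe_le_coe.1 ((h.disjoint ho hc).trans bot_le)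
  · exact Subtype.coe_le_coe.1 (le_top.trans (h.codisjoint ho hc))

theorem basicElem_sup (A : SZDBiframe L) (p p' : L × Lᵒᵈ) :
    A.basicElem (p ⊔ p') = A.basicElem p ⊔ A.basicElem p' := by
  apply Subtype.ext
  simp only [Subcolocale.coe_sup, coe_basicElem, basic_sup]

theorem basicElem_bot (A : SZDBiframe L) : A.basicElem ⊥ = ⊥ :=
  le_bot_iff.1 (Subtype.coe_le_coe.1 ((coe_basicElem A ⊥).trans basic_bot ▸ bot_le))

theorem basicElem_bot_left (A : SZDBiframe L) (a : L) : A.basicElem (⊥, toDual a) = A.closed a :=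
  Subtype.ext (by rw [coe_basicElem, basic, opens_bot, bot_sup_eq]; rfl)

/-- Only closed sublocales occur in the definition of a morphism; open ones follow as their
complements. -/
theorem isMorphism_iff_exists_basicElem {A : SZDBiframe L} {B : SZDBiframe M}
    {f : FrameHom L M} :
    A.IsMorphism B f ↔ ∃ g : CoframeHom A.sub.Elem B.sub.Elem,
      ∀ p, g.toFun (A.basicElem p) = B.basicElem (mapPair f p) := by
  constructor
  · rintro ⟨g, hg⟩
    have hopn (a : L) : g.toFun (A.opn a) = B.opn (f a) :=
      (g.map_isCompl (A.isCompl_opn_closed a)).left_unique (hg a ▸ B.isCompl_opn_closed (f a))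
    exact ⟨g, fun p => by rw [basicElem, g.map_sup', hopn, hg]; rfl⟩
  · rintro ⟨g, hg⟩
    refine ⟨g, fun a => ?_⟩
    rw [← basicElem_bot_left, hg, ← basicElem_bot_left]
    simp only [mapPair, map_bot, ofDual_toDual]

theorem isMorphism_iff_iInf_basicElem_le {A : SZDBiframe L} {B : SZDBiframe M} {f : FrameHom L M} :
    A.IsMorphism B f ↔ ∀ (X : Set (L × Lᵒᵈ)) (y : L × Lᵒᵈ),
      ⨅ p ∈ X, A.basicElem p ≤ A.basicElem y →
        ⨅ p ∈ X, B.basicElem (mapPair f p) ≤ B.basicElem (mapPair f y) := by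
  rw [isMorphism_iff_exists_basicElem]
  refine CoframeHom.exists_extension_iff (fun T T' h => le_of_forall_le_basic fun p hp => ?_)
    A.basicElem_sup A.basicElem_bot
    (fun p p' => by rw [mapPair_sup, basicElem_sup]) (by rw [mapPair_bot, basicElem_bot])
  exact A.le_basicElem_iff.1 (h p (A.le_basicElem_iff.2 hp))

variable {S : Sublocale L}

/-- The strictly zero-dimensional biframe induced on a sublocale `S` in the subcolocale: its
elements are the members of the subcolocale contained in `S`. -/
def induced (A : SZDBiframe L) (hS : S ∈ A.sub.carrier) : SZDBiframe S where
  sub :=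
    { carrier := {U | extend S U ∈ A.sub.carrier}
      sSup_mem' := fun s hs => by
        rw [Set.mem_ofPred_eq, (gc_extend_trace S).l_sSup, ← sSup_image]
        exact A.sub.sSup_mem' _ (Set.image_subset_iff.2 hs)
      sdiff_mem' := fun U hU V => by
        rw [Set.mem_ofPred_eq, extend_sdiff]
        exact A.sub.sdiff_mem' _ hU _ }
  top_mem := by rwa [Set.mem_ofPred_eq, extend_top]

theorem isMorphism_induced (A : SZDBiframe L) (hS : S ∈ A.sub.carrier) :
    A.IsMorphism (A.induced hS) S.restrict := by
  refine isMorphism_iff_iInf_basicElem_le.2 fun X y hXy => ?_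
  set U := ⨅ p ∈ X, (A.induced hS).basicElem (mapPair S.restrict p)
  let T : A.sub.Elem := ⟨extend S U, U.2⟩
  have hT : T ≤ ⨅ p ∈ X, A.basicElem p := le_iInf₂ fun p hp =>
    A.le_basicElem_iff.2 (extend_le_basic_iff.2 ((le_basicElem_iff _).1 (iInf₂_le p hp)))
  exact (le_basicElem_iff _).2 (extend_le_basic_iff.1 (A.le_basicElem_iff.1 (hT.trans hXy)))

theorem mem_of_isMorphism_restrict {A : SZDBiframe L} {B : SZDBiframe S}
    (h : A.IsMorphism B S.restrict) : S ∈ A.sub.carrier := by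
  have basic_restrict_eq_top (p : L × Lᵒᵈ) :
      B.basicElem (mapPair S.restrict p) = ⊤ ↔ S ≤ basic p := by
    rw [← top_le_iff, le_basicElem_iff, coe_top, ← extend_le_basic_iff, extend_top]
  let K : A.sub.Elem := ⨅ p ∈ {p | S ≤ basic p}, A.basicElem p
  have hK (y : L × Lᵒᵈ) : K ≤ A.basicElem y ↔ S ≤ basic y := by
    refine ⟨fun hy => ?_, fun hy => iInf₂_le y hy⟩
    rw [← basic_restrict_eq_top, ← top_le_iff]
    refine le_trans (le_iInf₂ fun p hp => ?_) (isMorphism_iff_iInf_basicElem_le.1 h _ y hy)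
    exact ((basic_restrict_eq_top p).2 hp).ge
  have hKS : (K : Sublocale L) = S :=
    le_antisymm (le_of_forall_le_basic fun p hp => A.le_basicElem_iff.1 ((hK p).2 hp))
      (le_of_forall_le_basic fun p hp => (hK p).1 (A.le_basicElem_iff.2 hp))
  exact hKS ▸ K.2

theorem induced_ofSb (hS : IsSmooth S) : (ofSb L).induced hS = ofSb S := by
  have hcarrier : ((ofSb L).induced hS).sub.carrier = (ofSb S).sub.carrier :=
    Set.ext fun _ => ⟨isSmooth_of_isSmooth_extend, isSmooth_extend hS⟩
  unfold induced ofSb Sb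
  congr

theorem isSmooth_iff_isMorphism_ofSb : IsSmooth S ↔ (ofSb L).IsMorphism (ofSb S) S.restrict :=
  ⟨fun hS => induced_ofSb hS ▸ isMorphism_induced (ofSb L) hS, mem_of_isMorphism_restrict⟩

end SZDBiframe

/-! ### Exact frame maps -/

section Exact

variable {L : Type u} {M : Type v} [Order.Frame L] [Order.Frame M]

/-- The inequality `⋀ X ≤ y` in the stable form `⋀ {x ∨ z | x ∈ X} ≤ y ∨ z` for all `z`. If `y` is
a lower bound of `X`, it says that `y` is the exact meet of `X`. -/
def StablySInfLE (X : Set L) (y : L) : Prop := ∀ z : L, ⨅ x ∈ X, x ⊔ z ≤ y ⊔ z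

theorem isExactMeet_and_sInf_eq_iff {X : Set L} {y : L} :
    IsExactMeet X ∧ sInf X = y ↔ y ∈ lowerBounds X ∧ StablySInfLE X y := by
  constructor
  · rintro ⟨h, rfl⟩
    exact ⟨fun _ => sInf_le, fun z => (h z).ge⟩
  · rintro ⟨hy, h⟩
    obtain rfl : sInf X = y := le_antisymm (by simpa [sInf_eq_iInf] using h ⊥) (le_sInf hy)
    exact ⟨fun z => le_antisymm (le_iInf₂ fun x hx => sup_le_sup_right (hy hx) z) (h z), rfl⟩

theorem StablySInfLE.isExactMeet_image_sup {X : Set L} {y : L} (h : StablySInfLE X y) :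
    IsExactMeet ((· ⊔ y) '' X) ∧ sInf ((· ⊔ y) '' X) = y := by
  refine isExactMeet_and_sInf_eq_iff.2 ⟨?_, fun z => ?_⟩
  · rintro _ ⟨x, -, rfl⟩
    exact le_sup_right
  · simpa only [iInf_image, sup_assoc, sup_left_idem] using h (y ⊔ z)

theorem isExactFrameHom_iff_stablySInfLE {f : FrameHom L M} :
    IsExactFrameHom f ↔ ∀ X y, StablySInfLE X y → StablySInfLE (f '' X) (f y) := by
  constructor
  · intro hf X y h z
    obtain ⟨hexact, hmeet⟩ := h.isExactMeet_image_sup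
    have hfy := (isExactMeet_and_sInf_eq_iff.1 (hmeet ▸ hf _ hexact)).2 z
    refine le_trans ?_ hfy
    simp only [iInf_image, map_sup]
    exact iInf₂_mono fun x _ => sup_le_sup_right le_sup_left z
  · intro hf X hX
    obtain ⟨hlb, hle⟩ := isExactMeet_and_sInf_eq_iff.1 ⟨hX, rfl⟩
    refine isExactMeet_and_sInf_eq_iff.2 ⟨?_, hf X _ hle⟩
    rintro _ ⟨x, hx, rfl⟩
    exact OrderHomClass.mono f (hlb hx)

open Sublocale SublocaleLattice

theorem forall_isSmooth_le_opens_iff {X : Set L} {y : L} :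
    (∀ T : Sublocale L, IsSmooth T → (∀ x ∈ X, T ≤ opens x) → T ≤ opens y) ↔
      StablySInfLE X y := by
  constructor
  · intro h z
    have hcompl : IsCompl (opens (⨅ x ∈ X, x ⊔ z) ⊓ closeds z) (closeds _ ⊔ opens z) :=
      (isCompl_opens_closeds _).inf_sup (isCompl_opens_closeds z).symm
    exact opens_inf_closeds_le_opens_iff.1 <| h _ (isSmooth_of_isComplemented ⟨_, hcompl⟩)
      fun x hx => opens_inf_closeds_le_opens_iff.2 (iInf₂_le x hx)
  · rintro h _ ⟨𝒞, h𝒞, rfl⟩ hX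
    refine sSup_le fun C hC => ?_
    obtain ⟨D, hD⟩ := h𝒞 C hC
    have hXD : ∀ x ∈ X, closeds x ≤ D := fun x hx =>
      (le_opens_iff_closeds_le hD).1 ((le_sSup hC).trans (hX x hx))
    refine (le_opens_iff_closeds_le hD).2 fun t ht => ?_
    have ht_eq : ⨅ x ∈ X, x ⊔ t = t :=
      le_antisymm ((h t).trans_eq (sup_eq_right.2 ht)) (le_iInf₂ fun _ _ => le_sup_right)
    rw [← ht_eq]
    exact iInf_mem fun x => iInf_mem fun hx => hXD x hx (mem_closeds.2 le_sup_left)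

end Exact

/-! ### Morphisms of Raney extensions -/

namespace RaneyExtension

open Sublocale SublocaleLattice

variable {L : Type u} {M : Type v} [Order.Frame L] [Order.Frame M]

theorem opn_sup (A : RaneyExtension L) (a b : L) : A.opn (a ⊔ b) = A.opn a ⊔ A.opn b := by
  apply Subtype.ext
  apply Subtype.ext
  rw [Subcolocale.coe_sup, Fitted.coe_sup]
  exact opens_sup a b

theorem opn_bot (A : RaneyExtension L) : A.opn ⊥ = ⊥ :=
  le_bot_iff.1 (opens_bot.le.trans bot_le : opens (⊥ : L) ≤ _)

theorem le_of_forall_le_opn {A : RaneyExtension L} {F G : A.sub.Elem}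
    (h : ∀ x, G ≤ A.opn x → F ≤ A.opn x) : F ≤ G := by
  obtain ⟨⟨_, X, rfl⟩, _⟩ := G
  exact (le_iInf₂ fun x hx => h x (iInf₂_le x hx : ⨅ x ∈ X, opens x ≤ opens x) :
    (F : Sublocale L) ≤ ⨅ x ∈ X, opens x)

theorem isMorphism_iff_iInf_opn_le {A : RaneyExtension L} {B : RaneyExtension M}
    {f : FrameHom L M} :
    A.IsMorphism B f ↔ ∀ (X : Set L) (y : L),
      ⨅ x ∈ X, A.opn x ≤ A.opn y → ⨅ x ∈ f '' X, B.opn x ≤ B.opn (f y) := by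
  simp only [iInf_image]
  exact CoframeHom.exists_extension_iff (fun _ _ => le_of_forall_le_opn) A.opn_sup A.opn_bot
    (fun a b => by rw [map_sup, opn_sup]) (by rw [map_bot, opn_bot])

end RaneyExtension

namespace SZDBiframe

open Sublocale

variable {L : Type u} {M : Type v} [Order.Frame L] [Order.Frame M]

theorem iInf_opn_fit_le_opn_iff (A : SZDBiframe L) {X : Set L} {y : L} :
    ⨅ x ∈ X, A.fit.opn x ≤ A.fit.opn y ↔
      ∀ T ∈ A.sub.carrier, (∀ x ∈ X, T ≤ opens x) → T ≤ opens y := by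
  let fitElem (T : A.sub.Elem) : A.fit.sub.Elem := ⟨fitMap T, T, T.2, rfl⟩
  have hfit (T : A.sub.Elem) (x : L) : fitElem T ≤ A.fit.opn x ↔ (T : Sublocale L) ≤ opens x :=
    fitMap_le_iff
  constructor
  · intro h T hT hX
    exact (hfit ⟨T, hT⟩ y).1 ((le_iInf₂ fun x hx => (hfit ⟨T, hT⟩ x).2 (hX x hx)).trans h)
  · intro h
    obtain ⟨T, hT, hTX⟩ := (⨅ x ∈ X, A.fit.opn x).2
    have hmeet : fitElem ⟨T, hT⟩ = ⨅ x ∈ X, A.fit.opn x := Subtype.ext hTX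
    rw [← hmeet, hfit]
    exact h T hT fun x hx => (hfit ⟨T, hT⟩ x).1 (hmeet.le.trans (iInf₂_le x hx))

theorem iInf_opn_fit_ofSb_le_opn_iff {X : Set L} {y : L} :
    ⨅ x ∈ X, (ofSb L).fit.opn x ≤ (ofSb L).fit.opn y ↔ StablySInfLE X y :=
  (iInf_opn_fit_le_opn_iff _).trans forall_isSmooth_le_opens_iff

theorem isExactFrameHom_iff_isMorphism_fit_ofSb {f : FrameHom L M} :
    IsExactFrameHom f ↔ (ofSb L).fit.IsMorphism (ofSb M).fit f := by
  simp only [isExactFrameHom_iff_stablySInfLE, RaneyExtension.isMorphism_iff_iInf_opn_le,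
    iInf_opn_fit_ofSb_le_opn_iff]

end SZDBiframe

theorem mainTheorem9_general {L : Type u} {M : Type v} [Order.Frame L] [Order.Frame M]
    (S : Sublocale L) (f : FrameHom L M) :
    (S.IsSmooth ↔
      SZDBiframe.IsMorphism (SZDBiframe.ofSb L) (SZDBiframe.ofSb S) S.restrict) ∧
    (IsExactFrameHom f ↔
      RaneyExtension.IsMorphism (SZDBiframe.ofSb L).fit (SZDBiframe.ofSb M).fit f) :=
  ⟨SZDBiframe.isSmooth_iff_isMorphism_ofSb, SZDBiframe.isExactFrameHom_iff_isMorphism_fit_ofSb⟩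

theorem mainTheorem9 {L : Type u} [Order.Frame L] (S : Sublocale L) :
    (S.IsSmooth ↔
      SZDBiframe.IsMorphism (SZDBiframe.ofSb L) (SZDBiframe.ofSb S) S.restrict) ∧
    (S.IsExact ↔
      RaneyExtension.IsMorphism (SZDBiframe.ofSb L).fit (SZDBiframe.ofSb S).fit S.restrict) :=
  mainTheorem9_general S S.restrict
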